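/- Let $X$ be a separable infinite-dimensional Banach space over $\mathbb{F}=\mathbb{R}$ or $\mathbb{C}$, and let $\mathcal{B}(X)$ be the algebra of bounded linear operators on $X$. For $M\ge 1$ and $T_1,\dots,T_M\in\mathcal{B}(X)$, let $\mathrm{d}\text{-}\mathcal{HC}(T_1,\dots,T_M)$ be the set of all $x\in X$ (the d-hypercyclic vectors) for which $\{(T_1^n x,\dots,T_M^n x) : n\in\mathbb{N}\}$ is dense in $X^M$; the operators $T_1,\dots,T_M$ are called d-hypercyclic if this set is nonempty (for $M=1$ this is ordinary hypercyclicity). Theorem. Let $N\ge 1$ and let $T_1,\dots,T_N\in\mathcal{B}(X)$ be d-hypercyclic. If $\mathcal{A}\subseteq \mathrm{d}\text{-}\mathcal{HC}(T_1,\dots,T_N)$ is countable and linearly independent, then the set $$\{T\in\mathcal{B}(X) : \mathcal{A}\subseteq \mathrm{d}\text{-}\mathcal{HC}(T_1,\dots,T_N,T)\}$$ is dense in $\mathcal{B}(X)$ for the strong operator topology (the topology of pointwise convergence on $X$). In particular, there exists $T\in\mathcal{B}(X)$ such that $T_1,\dots,T_N,T$ are d-hypercyclic. -/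

import Mathlib

/-- The set of d-hypercyclic vectors of a finite family `T` of bounded operators: those `x` for
which the joint orbit `{(T₁ⁿ x, …, T_Nⁿ x) : n ∈ ℕ}` is dense in the product space `X ^ N`.
For a single operator (`N = 1`) these are the hypercyclic vectors. -/
def dHC {𝕜 X : Type*} [RCLike 𝕜] [NormedAddCommGroup X] [NormedSpace 𝕜 X] {N : ℕ}
    (T : Fin N → X →L[𝕜] X) : Set X :=
  {x | Dense (Set.range fun n : ℕ => fun i : Fin N => (T i ^ n) x)}

/-- A finite family of bounded operators is d-hypercyclic if it has a d-hypercyclic vector. -/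
def IsDHypercyclic {𝕜 X : Type*} [RCLike 𝕜] [NormedAddCommGroup X] [NormedSpace 𝕜 X] {N : ℕ}
    (T : Fin N → X →L[𝕜] X) : Prop :=
  (dHC T).Nonempty

/-- The family `T₁, …, T_N, S` of `N + 1` operators. -/
def extendFamily {𝕜 X : Type*} [RCLike 𝕜] [NormedAddCommGroup X] [NormedSpace 𝕜 X] {N : ℕ}
    (T : Fin N → X →L[𝕜] X) (S : X →L[𝕜] X) : Fin (N + 1) → X →L[𝕜] X :=
  Fin.snoc (α := fun _ => X →L[𝕜] X) T S

/-- A set of bounded operators is SOT-dense if it is dense in `B(X)` for the strong operator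
topology, which is Mathlib's topology of pointwise convergence on `X →Lₚₜ[𝕜] X`. -/
def SOTDense {𝕜 X : Type*} [RCLike 𝕜] [NormedAddCommGroup X] [NormedSpace 𝕜 X]
    (C : Set (X →L[𝕜] X)) : Prop :=
  Dense (ContinuousLinearMap.toPointwiseConvergenceCLM 𝕜 (RingHom.id 𝕜) X X '' C)

/-! A vector `x` is d-hypercyclic for the extended family as soon as its orbit under the new
operator is dense along each return-time set of its joint orbit to a basic open set
(`mem_dHC_extendFamily`). For `x ∈ A` these sets are infinite, and there are countably many in all.
If `T₀` is mixing, Baire's theorem gives a dense set `G` of vectors whose `T₀`-orbits are dense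
along all of them. A nuclear perturbation `L = 1 + K` of the identity moves every vector of `A` into
`G`, and the conjugate `L⁻¹ T₀ L` is the required operator. As `‖K‖` is arbitrarily small, it stays
close to `T₀` (`exists_forall_dense_orbit_along`). It remains that mixing operators are SOT-dense.
One is built by making `P(t) ↦ P(t + 1)` bounded on a dense copy of the polynomials; its conjugates
come close to any `S` on any finite set (`exists_isMixingOperator_forall_norm_sub_lt`). -/

open Set Filter Topology

/-! ### Dual families, biorthogonal sequences, transitivity of invertible operators. -/

section LinearAlgebra

variable {𝕜 X : Type*} [RCLike 𝕜] [NormedAddCommGroup X] [NormedSpace 𝕜 X]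

/-- A finite linearly independent family in a normed space has a continuous dual family. -/
theorem LinearIndependent.exists_continuous_dual {ι : Type*} [Fintype ι] [DecidableEq ι]
    {e : ι → X} (he : LinearIndependent 𝕜 e) :
    ∃ f : ι → X →L[𝕜] 𝕜, ∀ i j, f i (e j) = if i = j then 1 else 0 := by
  have hinj : Function.Injective (Fintype.linearCombination 𝕜 e) :=
    LinearIndependent.fintypeLinearCombination_injective he
  have hs := (SeparatingDual.dualMap_surjective_iff (R := 𝕜) (V := X)).mpr hinj
  choose f hf using fun i => hs (LinearMap.proj i)
  refine ⟨f, fun i j => ?_⟩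
  have h := DFunLike.congr_fun (hf i) (Pi.single j 1)
  simpa [Fintype.linearCombination_apply_single, Pi.single_apply] using h

/-- A linearly independent sequence has a triangular family of continuous functionals. -/
theorem LinearIndependent.exists_triangular_dual {a : ℕ → X} (ha : LinearIndependent 𝕜 a) :
    ∃ f : ℕ → X →L[𝕜] 𝕜, ∀ k, f k (a k) = 1 ∧ ∀ j < k, f k (a j) = 0 := by
  have h : ∀ k, ∃ f : X →L[𝕜] 𝕜, f (a k) = 1 ∧ ∀ j < k, f (a j) = 0 := by
    intro k
    obtain ⟨f, hf⟩ := (ha.comp (fun i : Fin (k + 1) => (i : ℕ))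
      Fin.val_injective).exists_continuous_dual
    refine ⟨f (Fin.last k), by simpa using hf (Fin.last k) (Fin.last k), fun j hj => ?_⟩
    have := hf (Fin.last k) ⟨j, by omega⟩
    rw [if_neg (by simp [Fin.ext_iff]; omega)] at this
    exact this
  choose f hf using h
  exact ⟨f, hf⟩

/-- In a separable infinite-dimensional normed space, a countable linearly independent set is
contained in the range of a linearly independent sequence with dense span. -/
theorem exists_linearIndependent_seq_dense_span [TopologicalSpace.SeparableSpace X]
    (hX : ¬ FiniteDimensional 𝕜 X) {A : Set X} (hA : A.Countable)
    (hli : LinearIndependent 𝕜 ((↑) : A → X)) :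
    ∃ a : ℕ → X, LinearIndependent 𝕜 a ∧ A ⊆ range a ∧
      Dense (Submodule.span 𝕜 (range a) : Set X) := by
  obtain ⟨D, hDc, hD⟩ := TopologicalSpace.exists_countable_dense X
  obtain ⟨b, hbAD, hAb, hspan, hb⟩ := exists_linearIndepOn_id_extension
    (K := 𝕜) (s := A) (t := A ∪ D) hli subset_union_left
  have hbc : b.Countable := (hA.union hDc).mono hbAD
  have hdense : Dense (Submodule.span 𝕜 b : Set X) :=
    hD.mono (subset_union_right.trans hspan)
  have hinf : b.Infinite := by
    intro hfin
    apply hX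
    have : FiniteDimensional 𝕜 (Submodule.span 𝕜 b) := FiniteDimensional.span_of_finite 𝕜 hfin
    have hcl := (Submodule.span 𝕜 b).closed_of_finiteDimensional
    have htop : Submodule.span 𝕜 b = ⊤ := by
      rw [← SetLike.coe_set_eq, ← hcl.closure_eq, hdense.closure_eq]; rfl
    rw [htop] at this
    exact Module.finite_def.mpr (Module.Finite.iff_fg.mp this)
  have := hbc.to_subtype
  have := hinf.to_subtype
  obtain ⟨e⟩ := nonempty_denumerable b
  have hr : range (fun n => ((Denumerable.eqv b).symm n : X)) = b := by
    rw [show (fun n => ((Denumerable.eqv b).symm n : X)) =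
      Subtype.val ∘ (Denumerable.eqv b).symm from rfl, (Denumerable.eqv b).symm.surjective.range_comp]
    exact Subtype.range_coe
  refine ⟨fun n => ((Denumerable.eqv b).symm n : X), ?_, ?_, ?_⟩
  · exact LinearIndependent.comp hb _ (Denumerable.eqv b).symm.injective
  · rw [hr]; exact hAb
  · rw [hr]; exact hdense

/-- A separable infinite-dimensional normed space has a biorthogonal sequence with dense span. -/
theorem exists_biorthogonal_dense_span [TopologicalSpace.SeparableSpace X]
    (hX : ¬ FiniteDimensional 𝕜 X) :
    ∃ (x : ℕ → X) (f : ℕ → X →L[𝕜] 𝕜), (∀ i j, f i (x j) = if i = j then 1 else 0) ∧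
      Dense (Submodule.span 𝕜 (range x) : Set X) := by
  obtain ⟨a, ha, -, hd⟩ := exists_linearIndependent_seq_dense_span (𝕜 := 𝕜) hX
    (countable_empty (α := X)) (linearIndependent_empty 𝕜 X)
  obtain ⟨f, hf⟩ := ha.exists_triangular_dual
  -- Gram–Schmidt on the vectors only: the triangular functionals `f` are kept.
  let x : ℕ → X := fun k => Nat.strongRec (motive := fun _ => X)
    (fun k x => a k - ∑ i : Fin k, f i (a k) • x i i.2) k
  have hx : ∀ k, x k = a k - ∑ i : Fin k, f i (a k) • x i := by
    intro k
    simp only [x]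
    rw [Nat.strongRec_eq]
  have hzero : ∀ j k, j < k → f k (x j) = 0 := by
    intro j
    induction j using Nat.strong_induction_on with
    | _ j ih =>
      intro k hk
      rw [hx, map_sub, (hf k).2 j hk, map_sum, Finset.sum_eq_zero, sub_zero]
      intro i _
      rw [map_smul, ih i i.2 k (i.2.trans hk), smul_zero]
  have hone : ∀ k, f k (x k) = 1 := by
    intro k
    rw [hx, map_sub, (hf k).1, map_sum, Finset.sum_eq_zero, sub_zero]
    intro i _
    rw [map_smul, hzero i k i.2, smul_zero]
  have hzero' : ∀ k j, j < k → f j (x k) = 0 := by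
    intro k
    induction k using Nat.strong_induction_on with
    | _ k ih =>
      intro j hj
      rw [hx, map_sub, map_sum, Finset.sum_eq_single (⟨j, hj⟩ : Fin k)]
      · simp [hone]
      · intro i _ hi
        rw [map_smul]
        rcases lt_trichotomy (i : ℕ) j with h | h | h
        · rw [hzero i j h, smul_zero]
        · exact absurd (Fin.ext h) hi
        · rw [ih i i.2 j h, smul_zero]
      · simp
  refine ⟨x, f, fun i j => ?_, hd.mono (Submodule.span_le.mpr ?_)⟩
  · split_ifs with h
    · rw [h, hone]
    · rcases lt_or_gt_of_ne h with h | h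
      · exact hzero' j i h
      · exact hzero j i h
  · rintro _ ⟨k, rfl⟩
    have : a k = x k + ∑ i : Fin k, f i (a k) • x i := by rw [hx k]; abel
    rw [this]
    exact add_mem (Submodule.subset_span ⟨k, rfl⟩)
      (sum_mem fun i _ => Submodule.smul_mem _ _ (Submodule.subset_span ⟨i, rfl⟩))

/-- In an infinite-dimensional space there are arbitrarily many vectors independent modulo a given
finite-dimensional subspace. -/
theorem exists_linearIndependent_mkQ (hX : ¬ FiniteDimensional 𝕜 X) (F : Submodule 𝕜 X)
    [FiniteDimensional 𝕜 F] (n : ℕ) :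
    ∃ w : Fin n → X, LinearIndependent 𝕜 (F.mkQ ∘ w) := by
  have hQ : ¬ FiniteDimensional 𝕜 (X ⧸ F) := fun h =>
    hX (Module.Finite.of_submodule_quotient F)
  have hrank : (n : Cardinal) ≤ Module.rank 𝕜 (X ⧸ F) := by
    have : Cardinal.aleph0 ≤ Module.rank 𝕜 (X ⧸ F) := by
      by_contra h
      exact hQ (Module.rank_lt_aleph0_iff.mp (not_le.mp h))
    exact (Cardinal.natCast_lt_aleph0).le.trans this
  obtain ⟨v, hv⟩ := exists_linearIndependent_of_le_rank hrank
  choose w hw using fun i => F.mkQ_surjective (v i)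
  refine ⟨w, ?_⟩
  convert hv using 1
  exact funext hw

theorem LinearIndependent.sumElim_of_mkQ {F : Submodule 𝕜 X} {ι κ : Type*} {e : ι → X}
    (he : LinearIndependent 𝕜 e) (heF : ∀ i, e i ∈ F) {w : κ → X}
    (hw : LinearIndependent 𝕜 (F.mkQ ∘ w)) : LinearIndependent 𝕜 (Sum.elim e w) :=
  LinearIndependent.sumElim_of_quotient (f := fun i => (⟨e i, heF i⟩ : F))
    (LinearIndependent.of_comp F.subtype he) w hw

/-- If `e` and `w` are jointly independent finite families, some invertible operator maps `e`
to `w`. -/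
theorem exists_unit_map_of_sumElim {ι : Type*} [Fintype ι] [DecidableEq ι] {e w : ι → X}
    (h : LinearIndependent 𝕜 (Sum.elim e w)) :
    ∃ L : (X →L[𝕜] X)ˣ, (∀ i, (L : X →L[𝕜] X) (e i) = w i) ∧
      ∀ i, (L : X →L[𝕜] X) (w i) = e i := by
  obtain ⟨f, hf⟩ := h.exists_continuous_dual
  -- With `g i` equal to `1` at `e i` and `-1` at `w i`, the operator `L` below swaps `e i` and `w
  -- i` and fixes the common kernel, so it is an involution.
  let g : ι → X →L[𝕜] 𝕜 := fun i => f (Sum.inl i) - f (Sum.inr i)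
  have hge : ∀ i j, g i (e j) = if i = j then 1 else 0 := by
    intro i j
    have h1 := hf (Sum.inl i) (Sum.inl j)
    have h2 := hf (Sum.inr i) (Sum.inl j)
    simp at h1 h2
    simp [g, h1, h2]
  have hgw : ∀ i j, g i (w j) = if i = j then -1 else 0 := by
    intro i j
    have h1 := hf (Sum.inl i) (Sum.inr j)
    have h2 := hf (Sum.inr i) (Sum.inr j)
    simp at h1 h2
    simp [g, h1, h2]
    split_ifs <;> simp
  let L : X →L[𝕜] X := 1 + ∑ i, (g i).smulRight (w i - e i)
  have hL : ∀ x, L x = x + ∑ i, g i x • (w i - e i) := by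
    intro x; simp [L]
  have hLe : ∀ i, L (e i) = w i := by
    intro i; rw [hL]; simp [hge]
  have hLw : ∀ i, L (w i) = e i := by
    intro i; rw [hL]; simp [hgw]
  have hLL : L * L = 1 := by
    ext x
    have : L (L x) = x := by
      rw [hL x, map_add, map_sum]
      simp only [map_smul, map_sub, hLe, hLw]
      rw [hL x, add_assoc, ← Finset.sum_add_distrib]
      simp [← smul_add]
    simpa using this
  exact ⟨⟨L, L, hLL, hLL⟩, hLe, hLw⟩

/-- The invertible operators of an infinite-dimensional normed space act transitively on linearly
independent families of a given finite length. -/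
theorem exists_unit_map_of_linearIndependent (hX : ¬ FiniteDimensional 𝕜 X)
    {ι : Type*} [Fintype ι] [DecidableEq ι] {e u : ι → X}
    (he : LinearIndependent 𝕜 e) (hu : LinearIndependent 𝕜 u) :
    ∃ L : (X →L[𝕜] X)ˣ, ∀ i, (L : X →L[𝕜] X) (e i) = u i := by
  let F : Submodule 𝕜 X := Submodule.span 𝕜 (range e ∪ range u)
  have : FiniteDimensional 𝕜 F :=
    FiniteDimensional.span_of_finite 𝕜 ((finite_range e).union (finite_range u))
  -- The families `e` and `u` need not be jointly independent, so the map goes from `e` to `u`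
  -- through a third family independent modulo both spans.
  obtain ⟨w', hw'⟩ := exists_linearIndependent_mkQ hX F (Fintype.card ι)
  let w : ι → X := w' ∘ Fintype.equivFin ι
  have hw : LinearIndependent 𝕜 (F.mkQ ∘ w) := hw'.comp _ (Fintype.equivFin ι).injective
  obtain ⟨L₁, h₁, -⟩ := exists_unit_map_of_sumElim (he.sumElim_of_mkQ
    (fun i => Submodule.subset_span (Or.inl ⟨i, rfl⟩)) hw)
  obtain ⟨L₂, -, h₂⟩ := exists_unit_map_of_sumElim (hu.sumElim_of_mkQ
    (fun i => Submodule.subset_span (Or.inr ⟨i, rfl⟩)) hw)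
  exact ⟨L₂ * L₁, fun i => by simp [h₁, h₂]⟩

end LinearAlgebra

/-! ### Existence of a mixing operator. -/

section Mixing

variable {𝕜 E : Type*} [RCLike 𝕜] [NormedAddCommGroup E] [NormedSpace 𝕜 E]

/-- An operator is topologically mixing if, for nonempty open sets `U` and `V`, the image of `U`
under all sufficiently large powers of the operator meets `V`. -/
def IsMixingOperator (T : E →L[𝕜] E) : Prop :=
  ∀ U V : Set E, IsOpen U → IsOpen V → U.Nonempty → V.Nonempty →
    ∀ᶠ n : ℕ in atTop, ∃ x ∈ U, (T ^ n) x ∈ V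

/-- The nuclear operator `x ↦ ∑ fₖ(x) yₖ`. -/
theorem exists_nuclear_operator [CompleteSpace E] (f : ℕ → E →L[𝕜] 𝕜) (y : ℕ → E) {b : ℕ → ℝ}
    (hb : Summable b) (h : ∀ k, ‖f k‖ * ‖y k‖ ≤ b k) :
    ∃ K : E →L[𝕜] E, (∀ x, HasSum (fun k => f k x • y k) (K x)) ∧ ‖K‖ ≤ ∑' k, b k := by
  have hle : ∀ k, ‖(f k).smulRight (y k)‖ ≤ b k := fun k => by
    rw [ContinuousLinearMap.norm_smulRight_apply]; exact h k
  have hs : Summable fun k => (f k).smulRight (y k) := Summable.of_norm_bounded hb hle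
  refine ⟨∑' k, (f k).smulRight (y k), fun x => ?_, tsum_of_norm_bounded hb.hasSum hle⟩
  exact hs.hasSum.mapL (ContinuousLinearMap.apply 𝕜 E x)

open Polynomial in
/-- A separable infinite-dimensional Banach space carries a bounded operator that acts as the
translation `P(t) ↦ P(t + 1)` on a densely embedded copy of the space of polynomials. -/
theorem exists_translation_operator [CompleteSpace E] [TopologicalSpace.SeparableSpace E]
    (hX : ¬ FiniteDimensional 𝕜 E) :
    ∃ (φ : 𝕜[X] →ₗ[𝕜] E) (T : E →L[𝕜] E), Function.Injective φ ∧ DenseRange φ ∧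
      ∀ P, T (φ P) = φ (taylor 1 P) := by
  obtain ⟨x, f, hfx, hd⟩ := exists_biorthogonal_dense_span (𝕜 := 𝕜) hX
  -- Weights for `φ (X ^ k) = c k • x k`. They grow fast enough that `K`, which must send `c k • x
  -- k` to `s k = φ ((X + 1) ^ k - X ^ k)`, is nuclear.
  let c : ℕ → ℝ := fun k => Nat.strongRec (motive := fun _ => ℝ)
    (fun k c => 1 + 2 ^ k * (‖f k‖ * |∑ i : Fin k, (k.choose i : ℝ) * |c i i.2| * ‖x i‖|)) k
  have hc : ∀ k, c k = 1 + 2 ^ k * (‖f k‖ * |∑ i : Fin k, (k.choose i : ℝ) * |c i| * ‖x i‖|) := by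
    intro k
    simp only [c]
    rw [Nat.strongRec_eq]
  have hcpos : ∀ k, 0 < c k := by
    intro k; rw [hc]; positivity
  have hcne : ∀ k, (c k : 𝕜) ≠ 0 := fun k => by exact_mod_cast (hcpos k).ne'
  let s : ℕ → E := fun k => ∑ i ∈ Finset.range k, ((k.choose i : 𝕜) * (c i : 𝕜)) • x i
  have hs : ∀ k, ‖s k‖ ≤ |∑ i : Fin k, (k.choose i : ℝ) * |c i| * ‖x i‖| := by
    intro k
    refine le_trans (norm_sum_le _ _) (le_trans (le_of_eq ?_) (le_abs_self _))
    rw [Finset.sum_range]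
    refine Finset.sum_congr rfl fun i _ => ?_
    simp [norm_smul]
  obtain ⟨K, hK, -⟩ := exists_nuclear_operator f (fun k => (c k : 𝕜)⁻¹ • s k)
    summable_geometric_two (by
      intro k
      have h1 : ‖f k‖ * ‖s k‖ * 2 ^ k ≤ c k := by
        rw [hc]
        have := mul_le_mul_of_nonneg_left (hs k) (norm_nonneg (f k))
        nlinarith [pow_pos (two_pos (α := ℝ)) k]
      rw [norm_smul, norm_inv, RCLike.norm_ofReal, abs_of_pos (hcpos k), div_pow, one_pow,
        mul_left_comm, inv_mul_le_iff₀ (hcpos k), mul_one_div, le_div_iff₀ (by positivity)]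
      exact h1)
  have hKx : ∀ j, K (x j) = (c j : 𝕜)⁻¹ • s j := by
    intro j
    refine (hK (x j)).unique ?_
    convert hasSum_ite_eq j ((c j : 𝕜)⁻¹ • s j) using 2 with k
    rw [hfx]
    split_ifs with h <;> simp [h]
  let φ : 𝕜[X] →ₗ[𝕜] E := (basisMonomials 𝕜).constr 𝕜 (fun k => (c k : 𝕜) • x k)
  have hbasis : ∀ k, basisMonomials 𝕜 k = X ^ k := fun k => by
    rw [coe_basisMonomials]; exact monomial_one_right_eq_X_pow k
  have hφ : ∀ k, φ (X ^ k) = (c k : 𝕜) • x k := fun k => by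
    rw [← hbasis]; exact (basisMonomials 𝕜).constr_basis 𝕜 _ k
  refine ⟨φ, 1 + K, ?_, ?_, ?_⟩
  · rw [injective_iff_map_eq_zero]
    intro P hP
    -- Up to the nonzero factor `c k`, the functional `f k` reads off the `k`-th coefficient.
    have key : ∀ k, (f k : E →ₗ[𝕜] 𝕜) ∘ₗ φ = (c k : 𝕜) • lcoeff 𝕜 k := by
      intro k
      refine (basisMonomials 𝕜).ext fun j => ?_
      rw [hbasis]
      simp [hφ, hfx, coeff_X_pow]
      split_ifs with h <;> simp [h, RCLike.real_smul_eq_coe_mul]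
    ext k
    have := LinearMap.congr_fun (key k) P
    rw [LinearMap.comp_apply, hP, map_zero] at this
    exact (mul_eq_zero.mp this.symm).resolve_left (hcne k)
  · refine hd.mono (show (Submodule.span 𝕜 (range x) : Set E) ⊆ LinearMap.range φ from ?_)
    refine Submodule.span_le.mpr ?_
    rintro _ ⟨k, rfl⟩
    refine ⟨(c k : 𝕜)⁻¹ • X ^ k, ?_⟩
    rw [map_smul, hφ, smul_smul, inv_mul_cancel₀ (hcne k), one_smul]
  · intro P
    have key : ((1 + K : E →L[𝕜] E) : E →ₗ[𝕜] E) ∘ₗ φ = φ ∘ₗ taylor 1 := by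
      refine (basisMonomials 𝕜).ext fun k => ?_
      rw [hbasis]
      have h1 : taylor (1 : 𝕜) (X ^ k) =
          ∑ i ∈ Finset.range (k + 1), (k.choose i : 𝕜) • (X : 𝕜[X]) ^ i := by
        rw [taylor_apply, X_pow_comp, map_one, add_pow]
        refine Finset.sum_congr rfl fun i _ => ?_
        rw [one_pow, mul_one, smul_eq_C_mul, map_natCast, mul_comm]
      rw [LinearMap.comp_apply, LinearMap.comp_apply, h1, map_sum, Finset.sum_range_succ, hφ]
      simp only [map_smul, hφ, smul_smul]
      simp [hKx, smul_smul, hcne, s]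
      rw [add_comm]
    exact LinearMap.congr_fun key P

/-! ### Translation of polynomials is mixing. -/

section Translation

open Polynomial

variable {φ : 𝕜[X] →ₗ[𝕜] E} {T : E →L[𝕜] E}

theorem pow_translation_apply (hT : ∀ P, T (φ P) = φ (taylor 1 P)) (n : ℕ) (P : 𝕜[X]) :
    (T ^ n) (φ P) = φ (taylor (n : 𝕜) P) := by
  induction n generalizing P with
  | zero => simp
  | succ n ih =>
    rw [pow_succ, mul_apply_eq_comp, hT, ih, taylor_taylor]
    simp

/-- Rescaling the variable of a polynomial by `n⁻¹` and its values by `n ^ m` sends the multiples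
of `X ^ (m + 1)` to zero as `n → ∞`. -/
theorem tendsto_rescale_zero (φ : 𝕜[X] →ₗ[𝕜] E) (m : ℕ) {Q : 𝕜[X]} (hQ : X ^ (m + 1) ∣ Q) :
    Tendsto (fun n : ℕ => φ (C ((n : 𝕜) ^ m) * Q.comp (C (n : 𝕜)⁻¹ * X))) atTop (𝓝 0) := by
  obtain ⟨R, rfl⟩ := hQ
  induction R using Polynomial.induction_on' with
  | add p q hp hq =>
    have := hp.add hq
    rw [add_zero] at this
    refine this.congr fun n => ?_
    rw [← map_add, ← mul_add, mul_add (X ^ (m + 1)), add_comp]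
  | monomial i a =>
    have h0 : Tendsto (fun n : ℕ => ((n : 𝕜)⁻¹) ^ (i + 1)) atTop (𝓝 0) := by
      have := (tendsto_inv_atTop_nhds_zero_nat (𝕜 := 𝕜)).pow (i + 1)
      simpa using this
    have h1 := h0.smul_const (φ (X ^ (m + 1) * monomial i a))
    rw [zero_smul] at h1
    refine h1.congr' ?_
    filter_upwards [eventually_ne_atTop 0] with n hn
    have hn' : (n : 𝕜) ≠ 0 := Nat.cast_ne_zero.mpr hn
    rw [← map_smul]
    congr 1
    rw [mul_comp, X_pow_comp, monomial_comp, ← C_mul_X_pow_eq_monomial, smul_eq_C_mul, mul_pow,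
      mul_pow, ← C_pow, ← C_pow]
    have : ((n : 𝕜)⁻¹) ^ (i + 1) = (n : 𝕜) ^ m * (n : 𝕜)⁻¹ ^ (m + 1) * (n : 𝕜)⁻¹ ^ i := by
      rw [pow_succ _ m, ← mul_assoc, ← mul_pow, mul_inv_cancel₀ hn', one_pow, one_mul, pow_succ']
    rw [this, C_mul, C_mul]
    ring

/-- Solvability of the interpolation problem with vanishing data at `0` and prescribed data
at `1`. -/
theorem exists_dvd_taylor_sub (m : ℕ) (R : 𝕜[X]) :
    ∃ Q : 𝕜[X], X ^ m ∣ Q ∧ X ^ m ∣ taylor 1 Q - R := by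
  -- By the Chinese remainder theorem some `Q` is `0` modulo `X ^ m` and `R(X - 1)` modulo `(X - 1)
  -- ^ m`; shifting by `1` gives the second divisibility.
  have hco : IsCoprime ((X : 𝕜[X]) ^ m) ((X - C 1) ^ m) := by
    refine IsCoprime.pow ⟨1, -1, ?_⟩
    simp
  obtain ⟨a, b, hab⟩ := hco
  refine ⟨a * X ^ m * taylor (-1) R, ⟨a * taylor (-1) R, by ring⟩, ⟨-(taylor 1 b * R), ?_⟩⟩
  have h1 : a * X ^ m = 1 - b * (X - C 1) ^ m := by rw [← hab]; ring
  rw [h1, taylor_mul, taylor_taylor, map_sub, taylor_mul, taylor_pow]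
  simp
  ring

/-- After the substitution `X ↦ X / n`, translation by `n` becomes translation by `1`. So `n ^ m Q(X
/ n)` works for one fixed `Q`, found by interpolation to order `m + 1`. -/
theorem exists_tendsto_zero_pow_translation (hT : ∀ P, T (φ P) = φ (taylor 1 P)) (m : ℕ)
    (R : 𝕜[X]) :
    ∃ p : ℕ → E, Tendsto p atTop (𝓝 0) ∧
      Tendsto (fun n : ℕ => (T ^ n) (p n) - φ (C ((n : 𝕜) ^ m) * R.comp (C (n : 𝕜)⁻¹ * X)))
        atTop (𝓝 0) := by
  obtain ⟨Q, hQ, hQE⟩ := exists_dvd_taylor_sub (m + 1) R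
  refine ⟨fun n => φ (C ((n : 𝕜) ^ m) * Q.comp (C (n : 𝕜)⁻¹ * X)), tendsto_rescale_zero φ m hQ,
    (tendsto_rescale_zero φ m hQE).congr' ?_⟩
  filter_upwards [eventually_ne_atTop 0] with n hn
  have hn' : (n : 𝕜) ≠ 0 := Nat.cast_ne_zero.mpr hn
  rw [pow_translation_apply hT, ← map_sub]
  congr 1
  rw [taylor_mul, taylor_C, sub_comp, mul_sub]
  congr 2
  rw [taylor_apply, taylor_apply, comp_assoc, comp_assoc]
  congr 1
  simp only [mul_comp, add_comp, C_comp, X_comp]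
  rw [mul_add, ← C_mul, inv_mul_cancel₀ hn']

/-- For `R = a X ^ m`, homogeneity gives `n ^ m R(X / n) = R`. -/
theorem exists_tendsto_zero_image_tendsto (hT : ∀ P, T (φ P) = φ (taylor 1 P)) (P : 𝕜[X]) :
    ∃ p : ℕ → E, Tendsto p atTop (𝓝 0) ∧ Tendsto (fun n => (T ^ n) (p n)) atTop (𝓝 (φ P)) := by
  induction P using Polynomial.induction_on' with
  | add P Q hP hQ =>
    obtain ⟨p, hp, hp'⟩ := hP
    obtain ⟨q, hq, hq'⟩ := hQ
    refine ⟨fun n => p n + q n, by simpa using hp.add hq, ?_⟩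
    simpa using hp'.add hq'
  | monomial m a =>
    obtain ⟨p, hp, hp'⟩ := exists_tendsto_zero_pow_translation hT m (monomial m a)
    refine ⟨p, hp, ?_⟩
    have := hp'.add_const (φ (monomial m a))
    rw [zero_add] at this
    refine this.congr' ?_
    filter_upwards [eventually_ne_atTop 0] with n hn
    have hn' : (n : 𝕜) ≠ 0 := Nat.cast_ne_zero.mpr hn
    have : C ((n : 𝕜) ^ m) * (monomial m a).comp (C (n : 𝕜)⁻¹ * X) = monomial m a := by
      rw [monomial_comp, ← C_mul_X_pow_eq_monomial, mul_left_comm, C_pow, ← mul_pow, ← mul_assoc,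
        ← C_mul, mul_inv_cancel₀ hn', C_1, one_mul]
    rw [this, sub_add_cancel]

/-- For `R = -a (X + 1) ^ m`, the rescaled target is `-a (X + n) ^ m`, which cancels the image of `a
X ^ m` under `T ^ n`. -/
theorem exists_tendsto_zero_add_image_tendsto_zero (hT : ∀ P, T (φ P) = φ (taylor 1 P))
    (P : 𝕜[X]) :
    ∃ p : ℕ → E, Tendsto p atTop (𝓝 0) ∧
      Tendsto (fun n => (T ^ n) (φ P + p n)) atTop (𝓝 0) := by
  induction P using Polynomial.induction_on' with
  | add P Q hP hQ =>
    obtain ⟨p, hp, hp'⟩ := hP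
    obtain ⟨q, hq, hq'⟩ := hQ
    refine ⟨fun n => p n + q n, by simpa using hp.add hq, ?_⟩
    have := hp'.add hq'
    rw [add_zero] at this
    refine this.congr fun n => ?_
    rw [← map_add, map_add φ, add_add_add_comm]
  | monomial m a =>
    obtain ⟨p, hp, hp'⟩ := exists_tendsto_zero_pow_translation hT m
      (-taylor 1 (monomial m a))
    refine ⟨p, hp, hp'.congr' ?_⟩
    filter_upwards [eventually_ne_atTop 0] with n hn
    have hn' : (n : 𝕜) ≠ 0 := Nat.cast_ne_zero.mpr hn
    have : C ((n : 𝕜) ^ m) * (-taylor 1 (monomial m a)).comp (C (n : 𝕜)⁻¹ * X) =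
        -taylor (n : 𝕜) (monomial m a) := by
      rw [neg_comp, taylor_apply, taylor_apply, comp_assoc, monomial_comp, monomial_comp, mul_neg,
        mul_left_comm, C_pow, ← mul_pow]
      congr 3
      simp only [add_comp, C_comp, X_comp]
      rw [mul_add, ← mul_assoc, ← C_mul, ← C_mul, mul_inv_cancel₀ hn']
      simp
    rw [this, map_add, pow_translation_apply hT, map_neg]
    abel

theorem isMixingOperator_of_translation (hφ : DenseRange φ)
    (hT : ∀ P, T (φ P) = φ (taylor 1 P)) : IsMixingOperator T := by
  intro U V hU hV hUn hVn
  obtain ⟨P, hP⟩ := hφ.exists_mem_open hU hUn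
  obtain ⟨Q, hQ⟩ := hφ.exists_mem_open hV hVn
  obtain ⟨p, hp, hp'⟩ := exists_tendsto_zero_add_image_tendsto_zero hT P
  obtain ⟨q, hq, hq'⟩ := exists_tendsto_zero_image_tendsto hT Q
  have h1 : Tendsto (fun n => φ P + p n + q n) atTop (𝓝 (φ P)) := by
    simpa using (hp.const_add (φ P)).add hq
  have h2 : Tendsto (fun n => (T ^ n) (φ P + p n + q n)) atTop (𝓝 (φ Q)) := by
    simpa using hp'.add hq'
  filter_upwards [h1.eventually (hU.mem_nhds hP), h2.eventually (hV.mem_nhds hQ)] with n h3 h4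
  exact ⟨_, h3, h4⟩

/-- Polynomials `pᵢ` such that the `pᵢ` and their translates are jointly independent. -/
theorem exists_linearIndependent_taylor (k : ℕ) :
    ∃ p : Fin k → 𝕜[X], LinearIndependent 𝕜 (Sum.elim p fun i => taylor 1 (p i)) := by
  let v : ℕ → 𝕜 := fun n => n
  have hv : Function.Injective v := Nat.cast_injective
  -- On the nodes `0, …, 2k`, `p i` is nonzero only at `2i + 1`, so its translate is nonzero only at
  -- `2i` among `0, …, 2k - 1`. Odd nodes detect the `p i`, even ones the translates.
  let p : Fin k → 𝕜[X] := fun i => Lagrange.basis (Finset.range (2 * k + 1)) v (2 * i + 1)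
  have hp : ∀ (i : Fin k) (n : ℕ), n < 2 * k + 1 →
      (p i).eval (n : 𝕜) = if 2 * (i : ℕ) + 1 = n then 1 else 0 := by
    intro i n hn
    split_ifs with h
    · have := Lagrange.eval_basis_self (s := Finset.range (2 * k + 1)) (v := v) (i := n)
        hv.injOn (by simpa using hn)
      simpa [p, h, v] using this
    · exact Lagrange.eval_basis_of_ne (v := v) h (by simpa using hn)
  have hp' : ∀ (i : Fin k) (n : ℕ), n < 2 * k →
      (taylor 1 (p i)).eval (n : 𝕜) = if 2 * (i : ℕ) = n then 1 else 0 := by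
    intro i n hn
    have := hp i (n + 1) (by omega)
    rw [taylor_eval, ← Nat.cast_one, ← Nat.cast_add, this]
    simp
  refine ⟨p, LinearIndependent.of_pairwise_dual_eq_zero_one _
    (Sum.elim (fun i => leval ((2 * (i : ℕ) + 1 : ℕ) : 𝕜))
      fun i => leval ((2 * (i : ℕ) : ℕ) : 𝕜)) ?_ ?_⟩
  · rintro (i | i) (j | j) hij
    · have hne : j ≠ i := fun h => hij (by rw [h])
      have := hp j (2 * i + 1) (by omega)
      rw [if_neg (by omega)] at this
      exact this
    · have := hp' j (2 * i + 1) (by omega)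
      rw [if_neg (by omega)] at this
      exact this
    · have := hp j (2 * i) (by omega)
      rw [if_neg (by omega)] at this
      exact this
    · have hne : j ≠ i := fun h => hij (by rw [h])
      have := hp' j (2 * i) (by omega)
      rw [if_neg (by omega)] at this
      exact this
  · rintro (i | i)
    · have := hp i (2 * i + 1) (by omega)
      rwa [if_pos rfl] at this
    · have := hp' i (2 * i) (by omega)
      rwa [if_pos rfl] at this

end Translation

end Mixing

/-! ### SOT-density of mixing operators and prescribed dense orbits. -/

section Density

variable {𝕜 X : Type*} [RCLike 𝕜] [NormedAddCommGroup X] [NormedSpace 𝕜 X]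

theorem IsMixingOperator.conj {T : X →L[𝕜] X} (hT : IsMixingOperator T) (L : (X →L[𝕜] X)ˣ) :
    IsMixingOperator ((↑L⁻¹ : X →L[𝕜] X) * T * (L : X →L[𝕜] X)) := by
  intro U V hU hV hUn hVn
  have hinv : ∀ x, (↑L⁻¹ : X →L[𝕜] X) ((L : X →L[𝕜] X) x) = x := fun x => by
    rw [← mul_apply_eq_comp, Units.inv_mul]; rfl
  have hinv' : ∀ x, (L : X →L[𝕜] X) ((↑L⁻¹ : X →L[𝕜] X) x) = x := fun x => by
    rw [← mul_apply_eq_comp, Units.mul_inv]; rfl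
  have hne : ∀ W : Set X, W.Nonempty → ((↑L⁻¹ : X →L[𝕜] X) ⁻¹' W).Nonempty := by
    rintro W ⟨x, hx⟩
    exact ⟨(L : X →L[𝕜] X) x, by rwa [mem_preimage, hinv]⟩
  filter_upwards [hT _ _ (hU.preimage (↑L⁻¹ : X →L[𝕜] X).continuous)
    (hV.preimage (↑L⁻¹ : X →L[𝕜] X).continuous) (hne U hUn) (hne V hVn)] with n ⟨x, hxU, hxV⟩
  refine ⟨(↑L⁻¹ : X →L[𝕜] X) x, hxU, ?_⟩
  rw [Units.conj_pow']
  simpa [hinv'] using hxV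

/-- Mixing operators are dense for the strong operator topology. -/
theorem exists_isMixingOperator_forall_norm_sub_lt [CompleteSpace X]
    [TopologicalSpace.SeparableSpace X] (hX : ¬ FiniteDimensional 𝕜 X) (S : X →L[𝕜] X)
    {F : Set X} (hF : F.Finite) {ε : ℝ} (hε : 0 < ε) :
    ∃ T : X →L[𝕜] X, IsMixingOperator T ∧ ∀ x ∈ F, ‖T x - S x‖ < ε := by
  obtain ⟨φ, T₀, hinj, hdense, hT₀⟩ := exists_translation_operator (𝕜 := 𝕜) hX
  have hmix := isMixingOperator_of_translation hdense hT₀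
  let G : Submodule 𝕜 X := Submodule.span 𝕜 F
  have : FiniteDimensional 𝕜 G := FiniteDimensional.span_of_finite 𝕜 hF
  let b := Module.finBasis 𝕜 G
  let e : Fin (Module.finrank 𝕜 G) → X := fun i => b i
  have he : LinearIndependent 𝕜 e := b.linearIndependent.map' G.subtype G.ker_subtype
  let H : Submodule 𝕜 X := G ⊔ G.map (S : X →ₗ[𝕜] X)
  obtain ⟨w, hw⟩ := exists_linearIndependent_mkQ hX H (Module.finrank 𝕜 G)
  obtain ⟨f, hf⟩ := he.exists_continuous_dual
  let W : X →L[𝕜] X := ∑ i, (f i).smulRight (w i)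
  have hW : ∀ j, W (e j) = w j := by
    intro j; simp [W, hf]
  obtain ⟨η, hη, hη0⟩ : ∃ η : 𝕜, (∀ x ∈ F, ‖η • W x‖ < ε) ∧ η ≠ 0 := by
    have h1 : ∀ᶠ η : 𝕜 in 𝓝[≠] 0, ∀ x ∈ F, ‖η • W x‖ < ε := by
      refine nhdsWithin_le_nhds ((eventually_all_finite hF).mpr fun x _ => ?_)
      have : Tendsto (fun η : 𝕜 => ‖η • W x‖) (𝓝 0) (𝓝 0) := by
        have h : Continuous fun η : 𝕜 => ‖η • W x‖ := by fun_prop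
        simpa using h.tendsto 0
      exact this.eventually (gt_mem_nhds hε)
    exact (h1.and self_mem_nhdsWithin).exists
  -- The vectors `S (e i)` may depend on the `e i`; adding `η • w i` makes `e` and `v` jointly
  -- independent. They can then be carried to `φ (p i)` and its image under `T₀`, so that the
  -- conjugate of `T₀` maps `e i` to `v i`.
  let v : Fin (Module.finrank 𝕜 G) → X := fun i => S (e i) + η • w i
  have hv : LinearIndependent 𝕜 (H.mkQ ∘ v) := by
    have h1 := hw.units_smul (fun _ => Units.mk0 η hη0)
    convert h1 using 1
    ext i
    have : S (e i) ∈ H := Submodule.mem_sup_right ⟨e i, (b i).2, rfl⟩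
    simp [v, (Submodule.Quotient.mk_eq_zero H).mpr this, Units.smul_def]
  have hev := he.sumElim_of_mkQ (F := H) (fun i => Submodule.mem_sup_left (b i).2) hv
  obtain ⟨p, hp⟩ := exists_linearIndependent_taylor (𝕜 := 𝕜) (Module.finrank 𝕜 G)
  have hu := hp.map' φ (LinearMap.ker_eq_bot.mpr hinj)
  obtain ⟨L, hL⟩ := exists_unit_map_of_linearIndependent hX hev hu
  have hLe : ∀ i, (L : X →L[𝕜] X) (e i) = φ (p i) := fun i => hL (Sum.inl i)
  have hLv : ∀ i, (L : X →L[𝕜] X) (v i) = T₀ (φ (p i)) := fun i =>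
    (hL (Sum.inr i)).trans (hT₀ _).symm
  refine ⟨_, hmix.conj L, fun x hx => ?_⟩
  have key : (((↑L⁻¹ : X →L[𝕜] X) * T₀ * (L : X →L[𝕜] X) : X →L[𝕜] X) : X →ₗ[𝕜] X) ∘ₗ G.subtype =
      ((S + η • W : X →L[𝕜] X) : X →ₗ[𝕜] X) ∘ₗ G.subtype := by
    refine b.ext fun i => ?_
    change (↑L⁻¹ : X →L[𝕜] X) (T₀ ((L : X →L[𝕜] X) (e i))) = S (e i) + η • W (e i)
    rw [hLe, ← hLv, hW, ← mul_apply_eq_comp, Units.inv_mul]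
    rfl
  have hx' := LinearMap.congr_fun key ⟨x, Submodule.subset_span hx⟩
  change ((↑L⁻¹ : X →L[𝕜] X) * T₀ * (L : X →L[𝕜] X)) x = S x + η • W x at hx'
  rw [hx', add_sub_cancel_left]
  exact hη x hx

/-- For a mixing operator and countably many infinite sets of exponents, a dense set of vectors has
dense orbits along all these sets. -/
theorem IsMixingOperator.dense_setOf_forall_dense [CompleteSpace X]
    [TopologicalSpace.SeparableSpace X] {T : X →L[𝕜] X} (hT : IsMixingOperator T)
    {ι : Type*} [Countable ι] {s : ι → Set ℕ} (hs : ∀ i, (s i).Infinite) :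
    Dense {x | ∀ i, Dense ((fun n => (T ^ n) x) '' s i)} := by
  have : SecondCountableTopology X := UniformSpace.secondCountable_of_separable X
  let B := TopologicalSpace.countableBasis X
  have hB := TopologicalSpace.isBasis_countableBasis X
  have : Countable B := (TopologicalSpace.countable_countableBasis X).to_subtype
  -- Baire category. Mixing supplies all large exponents, hence some in the infinite set `s q.1`.
  have hd : Dense (⋂ q : ι × B, ⋃ n ∈ s q.1, (T ^ n) ⁻¹' (q.2 : Set X)) := by
    refine dense_iInter_of_isOpen (fun q => ?_) fun q => ?_
    · exact isOpen_biUnion fun n _ => (hB.isOpen q.2.2).preimage (T ^ n).continuous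
    · rw [dense_iff_inter_open]
      intro U hU hUn
      have hV := TopologicalSpace.nonempty_of_mem_countableBasis q.2.2
      obtain ⟨n, hn, x, hxU, hxV⟩ := ((Nat.frequently_atTop_iff_infinite.mpr (hs q.1)).and_eventually
        (hT U q.2 hU (hB.isOpen q.2.2) hUn hV)).exists
      exact ⟨x, hxU, mem_iUnion₂.mpr ⟨n, hn, hxV⟩⟩
  refine hd.mono fun x hx i => ?_
  rw [hB.dense_iff]
  intro V hV _
  obtain ⟨n, hn, hxV⟩ := mem_iUnion₂.mp (mem_iInter.mp hx (i, ⟨V, hV⟩))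
  exact ⟨_, hxV, n, hn, rfl⟩

/-- A linearly independent sequence can be moved into a given dense set by an arbitrarily small
perturbation of the identity. -/
theorem LinearIndependent.exists_small_add_mem [CompleteSpace X] {a : ℕ → X}
    (ha : LinearIndependent 𝕜 a) {G : Set X} (hG : Dense G) {δ : ℝ} (hδ : 0 < δ) :
    ∃ K : X →L[𝕜] X, ‖K‖ < δ ∧ ∀ k, a k + K (a k) ∈ G := by
  obtain ⟨f, hf⟩ := ha.exists_triangular_dual
  have hstep : ∀ (k : ℕ) (z : X), ∃ y : X, ‖f k‖ * ‖y‖ ≤ δ / 4 * (1 / 2) ^ k ∧ z + y ∈ G := by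
    intro k z
    have hr : 0 < δ / 4 * (1 / 2) ^ k / (‖f k‖ + 1) := by positivity
    obtain ⟨g, hg, hgz⟩ := Metric.dense_iff.mp hG z _ hr
    refine ⟨g - z, ?_, by simpa using hgz⟩
    rw [Metric.mem_ball, dist_eq_norm, lt_div_iff₀ (by positivity)] at hg
    nlinarith [norm_nonneg (g - z)]
  choose Y hYb hYG using hstep
  -- Since `f i (a k) = 0` for `i > k`, `K (a k)` involves only `y 0, …, y k`; `y k` has coefficient
  -- `1` and is chosen last to land in `G`. The bounds sum to `δ / 2`.
  let y : ℕ → X := fun k => Nat.strongRec (motive := fun _ => X)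
    (fun k y => Y k (a k + ∑ i : Fin k, f i (a k) • y i i.2)) k
  have hy : ∀ k, y k = Y k (a k + ∑ i : Fin k, f i (a k) • y i) := by
    intro k
    simp only [y]
    rw [Nat.strongRec_eq]
  obtain ⟨K, hK, hKn⟩ := exists_nuclear_operator f y
    (summable_geometric_two.mul_left (δ / 4)) (fun k => by rw [hy]; exact hYb k _)
  refine ⟨K, ?_, fun k => ?_⟩
  · rw [tsum_mul_left, tsum_geometric_two] at hKn
    linarith
  · have h1 : K (a k) = ∑ i ∈ Finset.range (k + 1), f i (a k) • y i := by
      refine (hK (a k)).unique (hasSum_sum_of_ne_finset_zero fun i hi => ?_)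
      rw [(hf i).2 k (by simpa using hi), zero_smul]
    rw [h1, Finset.sum_range_succ, (hf k).1, one_smul, ← add_assoc, Finset.sum_range, hy k]
    exact hYG k _

/-- Near any bounded operator in the strong operator topology there is an operator under which every
vector of a given countable independent set has dense orbits along given infinite sets of
exponents. -/
theorem exists_forall_dense_orbit_along [CompleteSpace X] [TopologicalSpace.SeparableSpace X]
    (hX : ¬ FiniteDimensional 𝕜 X) {A : Set X} (hA : A.Countable)
    (hli : LinearIndependent 𝕜 ((↑) : A → X)) {ι : Type*} [Countable ι] {s : ι → Set ℕ}
    (hs : ∀ i, (s i).Infinite) (S : X →L[𝕜] X) {F : Set X} (hF : F.Finite) {ε : ℝ} (hε : 0 < ε) :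
    ∃ T : X →L[𝕜] X, (∀ x ∈ F, ‖T x - S x‖ < ε) ∧
      ∀ x ∈ A, ∀ i, Dense ((fun n => (T ^ n) x) '' s i) := by
  obtain ⟨T₀, hmix, hT₀⟩ := exists_isMixingOperator_forall_norm_sub_lt hX S hF hε
  obtain ⟨a, ha, hAa, -⟩ := exists_linearIndependent_seq_dense_span hX hA hli
  -- Conjugation is norm continuous at the identity, so any `M` close to `1` preserves the
  -- approximation on `F`.
  have hclose : ∀ᶠ M : X →L[𝕜] X in 𝓝 1,
      IsUnit M ∧ ∀ x ∈ F, ‖(Ring.inverse M * T₀ * M) x - S x‖ < ε := by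
    have hunit : ∀ᶠ M : X →L[𝕜] X in 𝓝 1, IsUnit M := Units.nhds (1 : (X →L[𝕜] X)ˣ)
    refine hunit.and ((eventually_all_finite hF).mpr fun x hx => ?_)
    have hinv : Tendsto Ring.inverse (𝓝 (1 : X →L[𝕜] X)) (𝓝 1) := by
      have := (NormedRing.inverse_continuousAt (1 : (X →L[𝕜] X)ˣ)).tendsto
      simpa using this
    have h1 : Tendsto (fun M : X →L[𝕜] X => Ring.inverse M * T₀ * M) (𝓝 1) (𝓝 T₀) := by
      simpa using (hinv.mul_const T₀).mul tendsto_id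
    have h2 := ((ContinuousLinearMap.apply 𝕜 X x).continuous.tendsto T₀).comp h1
    exact (h2.sub_const (S x)).norm.eventually (gt_mem_nhds (hT₀ x hx))
  obtain ⟨δ, hδ, hball⟩ := Metric.eventually_nhds_iff.mp hclose
  obtain ⟨K, hK, hKa⟩ := ha.exists_small_add_mem (hmix.dense_setOf_forall_dense hs) hδ
  obtain ⟨⟨L, hL⟩, hLF⟩ := hball (y := 1 + K) (by simpa [dist_eq_norm] using hK)
  rw [← hL, Ring.inverse_unit] at hLF
  refine ⟨_, hLF, fun x hx i => ?_⟩
  obtain ⟨k, rfl⟩ := hAa hx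
  have hsurj : Function.Surjective (↑L⁻¹ : X →L[𝕜] X) := fun z =>
    ⟨(L : X →L[𝕜] X) z, by rw [← mul_apply_eq_comp, Units.inv_mul]; rfl⟩
  have hd := hsurj.denseRange.dense_image (↑L⁻¹ : X →L[𝕜] X).continuous (hKa k i)
  rw [image_image] at hd
  refine (congrArg Dense (image_congr fun n _ => ?_)).mp hd
  rw [Units.conj_pow', hL]
  simp

end Density

/-! ### Return times and the passage to the extended family. -/

section DisjointHypercyclic

variable {𝕜 X : Type*} [RCLike 𝕜] [NormedAddCommGroup X] [NormedSpace 𝕜 X] {N : ℕ}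
  {T : Fin N → X →L[𝕜] X}

/-- The joint orbit of a d-hypercyclic vector visits every nonempty open set infinitely often. -/
theorem infinite_setOf_mem_of_mem_dHC [Nontrivial X] (hN : 1 ≤ N) {x : X} (hx : x ∈ dHC T)
    {U : Set (Fin N → X)} (hU : IsOpen U) (hUn : U.Nonempty) :
    {n : ℕ | (fun i => (T i ^ n) x) ∈ U}.Infinite := by
  intro hfin
  have : Nonempty (Fin N) := ⟨⟨0, hN⟩⟩
  -- Without isolated points, a dense set stays dense after removal of finitely many points.
  have : ∀ y : Fin N → X, NeBot (𝓝[≠] y) := fun y => Module.punctured_nhds_neBot 𝕜 _ y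
  have hd : Dense (range fun n : ℕ => fun i : Fin N => (T i ^ n) x) := hx
  obtain ⟨_, hyU, ⟨n, rfl⟩, hn⟩ := (hd.sdiff_finite
    (hfin.image fun n : ℕ => fun i : Fin N => (T i ^ n) x)).inter_open_nonempty U hU hUn
  exact hn ⟨n, hyU, rfl⟩

theorem extendFamily_pow_apply (T : Fin N → X →L[𝕜] X) (S : X →L[𝕜] X) (n : ℕ) (x : X) :
    (fun i => (extendFamily T S i ^ n) x) =
      Fin.snoc (α := fun _ => X) (fun i => (T i ^ n) x) ((S ^ n) x) := by
  funext i
  refine Fin.lastCases ?_ (fun i => ?_) i <;> simp [extendFamily]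

/-- If the orbit of `x` under `S` is dense along the return times of the joint orbit of `x` under
`T` to the members of a basis, then `x` is d-hypercyclic for the extended family. -/
theorem mem_dHC_extendFamily {S : X →L[𝕜] X} {x : X} {B : Set (Set (Fin N → X))}
    (hB : TopologicalSpace.IsTopologicalBasis B)
    (h : ∀ U ∈ B, U.Nonempty →
      Dense ((fun n : ℕ => (S ^ n) x) '' {n | (fun i => (T i ^ n) x) ∈ U})) :
    x ∈ dHC (extendFamily T S) := by
  change Dense _
  rw [dense_iff_inter_open]
  rintro O hO ⟨y, hy⟩
  let g : (Fin N → X) × X → Fin (N + 1) → X := fun q => Fin.snoc (α := fun _ => X) q.1 q.2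
  have hg : Continuous g := Continuous.finSnoc continuous_fst continuous_snd
  have hmem : g (fun i => y i.castSucc, y (Fin.last N)) ∈ O := by
    have : g (fun i => y i.castSucc, y (Fin.last N)) = y := Fin.snoc_init_self y
    rwa [this]
  obtain ⟨V, W, hV, hW, hyV, hyW, hVW⟩ := isOpen_prod_iff.mp (hO.preimage hg) _ _ hmem
  obtain ⟨U, hUB, hyU, hUV⟩ := hB.exists_subset_of_mem_open hyV hV
  obtain ⟨_, hzW, n, hn, rfl⟩ := (h U hUB ⟨_, hyU⟩).inter_open_nonempty W hW ⟨_, hyW⟩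
  refine ⟨_, ?_, n, rfl⟩
  dsimp only
  rw [extendFamily_pow_apply]
  exact hVW (mk_mem_prod (hUV hn) hzW)

/-- A set of operators that contains uniform approximations of every operator on every finite set
is dense for the strong operator topology. -/
theorem sotDense_of_forall_finite {C : Set (X →L[𝕜] X)}
    (h : ∀ (S : X →L[𝕜] X) (F : Set X), F.Finite → ∀ ε : ℝ, 0 < ε →
      ∃ R ∈ C, ∀ x ∈ F, ‖R x - S x‖ < ε) : SOTDense C := by
  intro S
  rw [mem_closure_iff_nhds]
  intro t ht
  have hb := (PointwiseConvergenceCLM.hasBasis_nhds_zero_of_basis (σ := RingHom.id 𝕜) (E := X)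
    (F := X) Metric.nhds_basis_ball).map (S + ·)
  rw [map_add_left_nhds_zero] at hb
  obtain ⟨⟨F, ε⟩, ⟨hF, hε⟩, hsub⟩ := hb.mem_iff.mp ht
  obtain ⟨R, hR, hRS⟩ := h S F hF ε hε
  refine ⟨ContinuousLinearMap.toPointwiseConvergenceCLM 𝕜 (RingHom.id 𝕜) X X R, hsub ?_,
    mem_image_of_mem _ hR⟩
  refine ⟨ContinuousLinearMap.toPointwiseConvergenceCLM 𝕜 (RingHom.id 𝕜) X X R - S, fun x hx => ?_,
    add_sub_cancel _ _⟩
  rw [mem_ball_zero_iff]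
  exact hRS x hx

/-- The prescribed exponent sets are the return times, indexed by a vector of `A` and a basic open
set. -/
theorem sotDense_setOf_subset_dHC_extendFamily [CompleteSpace X]
    [TopologicalSpace.SeparableSpace X] (hX : ¬ FiniteDimensional 𝕜 X) (hN : 1 ≤ N) {A : Set X}
    (hAT : A ⊆ dHC T) (hA : A.Countable) (hli : LinearIndependent 𝕜 ((↑) : A → X)) :
    SOTDense {S : X →L[𝕜] X | A ⊆ dHC (extendFamily T S)} := by
  have : Nontrivial X := by
    by_contra h
    rw [not_nontrivial_iff_subsingleton] at h
    exact hX inferInstance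
  have : SecondCountableTopology X := UniformSpace.secondCountable_of_separable X
  let B := TopologicalSpace.countableBasis (Fin N → X)
  have hB := TopologicalSpace.isBasis_countableBasis (Fin N → X)
  have : Countable B := (TopologicalSpace.countable_countableBasis _).to_subtype
  have : Countable A := hA.to_subtype
  refine sotDense_of_forall_finite fun S F hF ε hε => ?_
  obtain ⟨R, hRS, hR⟩ := exists_forall_dense_orbit_along hX hA hli
    (s := fun q : A × B => {n : ℕ | (fun i => (T i ^ n) (q.1 : X)) ∈ (q.2 : Set (Fin N → X))})
    (fun q => infinite_setOf_mem_of_mem_dHC hN (hAT q.1.2) (hB.isOpen q.2.2)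
      (TopologicalSpace.nonempty_of_mem_countableBasis q.2.2)) S hF hε
  exact ⟨R, fun x hx => mem_dHC_extendFamily hB fun U hU _ => hR x hx (⟨x, hx⟩, ⟨U, hU⟩), hRS⟩

theorem ne_zero_of_mem_dHC [Nontrivial X] (hN : 1 ≤ N) {x : X} (hx : x ∈ dHC T) : x ≠ 0 := by
  rintro rfl
  obtain ⟨y, hy⟩ := exists_ne (0 : X)
  have hopen : IsOpen {z : Fin N → X | z ⟨0, hN⟩ ≠ 0} :=
    isOpen_ne.preimage (continuous_apply (⟨0, hN⟩ : Fin N))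
  obtain ⟨n, hn⟩ := (infinite_setOf_mem_of_mem_dHC hN hx hopen ⟨fun _ => y, hy⟩).nonempty
  exact hn (map_zero _)

end DisjointHypercyclic

theorem theorem2p1 {𝕜 X : Type*} [RCLike 𝕜] [NormedAddCommGroup X] [NormedSpace 𝕜 X]
    [CompleteSpace X] [TopologicalSpace.SeparableSpace X] (hX : ¬ FiniteDimensional 𝕜 X)
    {N : ℕ} (hN : 1 ≤ N) (T : Fin N → X →L[𝕜] X) (hT : IsDHypercyclic T) :
    (∀ A : Set X, A ⊆ dHC T → A.Countable → LinearIndependent 𝕜 ((↑) : A → X) →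
      SOTDense {S : X →L[𝕜] X | A ⊆ dHC (extendFamily T S)}) ∧
    ∃ S : X →L[𝕜] X, IsDHypercyclic (extendFamily T S) := by
  refine ⟨fun A hAT hA hli => sotDense_setOf_subset_dHC_extendFamily hX hN hAT hA hli, ?_⟩
  have : Nontrivial X := by
    by_contra h
    rw [not_nontrivial_iff_subsingleton] at h
    exact hX inferInstance
  obtain ⟨x, hx⟩ := hT
  have hd := sotDense_setOf_subset_dHC_extendFamily hX hN (singleton_subset_iff.mpr hx)
    (countable_singleton x) (LinearIndepOn.singleton (v := id) (ne_zero_of_mem_dHC hN hx))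
  obtain ⟨_, S, hS, -⟩ := Dense.nonempty hd
  exact ⟨S, x, hS (mem_singleton x)⟩
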